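/- **Theorem (Maximal Prescience).** Let $\mathcal X,\mathcal Y$ be nonempty finite or countable alphabets. Let a *channel* be given, i.e. a probability kernel $x\mapsto \mathbb P(\,\cdot\mid x)$ from bi-infinite input sequences $x\in\mathcal X^{\mathbb Z}$ to laws on bi-infinite output sequences $Y\in\mathcal Y^{\mathbb Z}$, which is *stationary* (translating the input by any $t\in\mathbb Z$ translates the output law by $t$) and *causal* (for all $t\in\mathbb Z$, $L\in\mathbb N$, the law of $Y_t\dots Y_{t+L-1}$ given $x$ depends only on $(x_s)_{s<t+L}$). Let $X$ be a stationary input process, and let $(X,Y)$ be the joint process obtained by driving the channel with $X$. Write $\overleftarrow{Z}=(\overleftarrow X,\overleftarrow Y)$ for the joint past (times $<0$) and $\overrightarrow X,\overrightarrow Y$ for the input and output futures (times $\ge 0$). A *future morph* of the channel is a version of the regular conditional law $\mathbb P(\overrightarrow Y\in\cdot\mid \overrightarrow X=\overrightarrow x,\overleftarrow Z=\overleftarrow z)$ determined by the channel: a probability kernel $\eta$ such that for every input sequence $x=(\overleftarrow x,\overrightarrow x)$, under $\mathbb P(\,\cdot\mid x)$ the law $\eta\big((\overleftarrow x,\overleftarrow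 Y),\overrightarrow x\big)$ is a conditional law of $\overrightarrow Y$ given $\overleftarrow Y$. Fix any such version. Two joint pasts are *causally equivalent* if $\eta(\overleftarrow z,\overrightarrow x)=\eta(\overleftarrow z',\overrightarrow x)$ for all $\overrightarrow x$; the equivalence classes are the *causal states*, and $\mathcal S$ denotes the causal state of $\overleftarrow Z$. A *rival partition* is an arbitrary partition of the set of all joint pasts, and $\mathcal R$ denotes the cell of $\overleftarrow Z$. Spaces of cells carry the quotient $\sigma$-algebra. The *prescience* of $\mathcal R$ is the conditional mutual information $I[\mathcal R;\overrightarrow Y\mid\overrightarrow X]\in[0,\infty]$. Then $$I[\mathcal S;\overrightarrow Y\mid\overrightarrow X]=I[\overleftarrow Z;\overrightarrow Y\mid\overrightarrow X]\ \ge\ I[\mathcal R;\overrightarrow Y\mid\overrightarrow X]$$ for every rival partition. Moreover, for every finite length $L\ge 0$ and every rival partition, with $X_{0:L}=X_0\dots X_{L-1}$ and $Y_{0:L}=Y_0\dots Y_{L-1}$, $$I[\mathcal S;Y_{0:L}\mid X_{0:L}]=I[\overleftarrow Z;Y_{0:L}\mid X_{0:L}]\ \ge\ I[\mathcal R;Y_{0:L}\mid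 X_{0:L}].$$ -/

import Mathlib

open MeasureTheory ProbabilityTheory InformationTheory
open scoped ENNReal

namespace TransducerPrescience

/-- The time shift `x ↦ (x_{s+t})_s` on bi-infinite sequences. -/
def shift {α : Type*} (t : ℤ) (x : ℤ → α) : ℤ → α := fun s => x (s + t)

/-- The past `… x₋₂ x₋₁` of a bi-infinite sequence, read backwards from time `-1`:
the `n`-th entry is `x₋₁₋ₙ`. -/
def past {α : Type*} (x : ℤ → α) : ℕ → α := fun n => x (-1 - (n : ℤ))

/-- The future `x₀ x₁ …` of a bi-infinite sequence. -/
def future {α : Type*} (x : ℤ → α) : ℕ → α := fun n => x (n : ℤ)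

/-- The block `x_t x_{t+1} … x_{t+L-1}` of length `L` beginning at time `t`. -/
def block {α : Type*} (t : ℤ) (L : ℕ) (x : ℤ → α) : Fin L → α := fun i => x (t + (i : ℕ))

lemma measurable_past {α : Type*} [MeasurableSpace α] :
    Measurable (past : (ℤ → α) → (ℕ → α)) :=
  measurable_pi_lambda _ fun _ => measurable_pi_apply _

lemma measurable_future {α : Type*} [MeasurableSpace α] :
    Measurable (future : (ℤ → α) → (ℕ → α)) :=
  measurable_pi_lambda _ fun _ => measurable_pi_apply _

/-- A process (a law on bi-infinite sequences) is stationary if it is invariant under all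
time translations. -/
def IsStationaryProcess {X : Type*} [MeasurableSpace X] (μ : Measure (ℤ → X)) : Prop :=
  ∀ t : ℤ, μ.map (shift t) = μ

/-- A channel with input alphabet `X` and output alphabet `Y` is a Markov kernel from bi-infinite
input sequences to bi-infinite output sequences. It is stationary if translating the input
sequence translates the output law. -/
def IsStationaryChannel {X Y : Type*} [MeasurableSpace X] [MeasurableSpace Y]
    (κ : Kernel (ℤ → X) (ℤ → Y)) : Prop :=
  ∀ (t : ℤ) (x : ℤ → X), κ (shift t x) = (κ x).map (shift t)

/-- A channel is causal (anticipation-free) if the law of each output block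
`Y_t … Y_{t+L-1}` depends only on the inputs at times earlier than `t + L`. -/
def IsCausalChannel {X Y : Type*} [MeasurableSpace X] [MeasurableSpace Y]
    (κ : Kernel (ℤ → X) (ℤ → Y)) : Prop :=
  ∀ (t : ℤ) (L : ℕ) (x x' : ℤ → X), (∀ s : ℤ, s < t + L → x s = x' s) →
    (κ x).map (block t L) = (κ x').map (block t L)

/-- Joint pasts: pairs (input past, output past). -/
abbrev JointPast (X Y : Type*) : Type _ := (ℕ → X) × (ℕ → Y)

/-- The joint past of a pair (input sequence, output sequence). -/
def jointPast {X Y : Type*} (ω : (ℤ → X) × (ℤ → Y)) : JointPast X Y := (past ω.1, past ω.2)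

/-- `η` is a version of the channel's future morphs: `η (z, f)` is the conditional law
`ℙ(future output | future input = f, joint past = z)`. That is, for every input sequence `x`,
the law of (output past, output future) under `κ x` is the law of the output past, composed with
the kernel `q ↦ η ((past x, q), future x)`. -/
def IsFutureMorph {X Y : Type*} [MeasurableSpace X] [MeasurableSpace Y]
    (κ : Kernel (ℤ → X) (ℤ → Y)) (η : Kernel (JointPast X Y × (ℕ → X)) (ℕ → Y)) : Prop :=
  ∀ x : ℤ → X, (κ x).map (fun y => (past y, future y)) =
    ((κ x).map past) ⊗ₘ
      (η.comap (fun q : ℕ → Y => ((past x, q), future x))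
        ((measurable_const.prodMk measurable_id).prodMk measurable_const))

/-- Causal equivalence of joint pasts: the conditional laws of the future output, as functions of
the future input, coincide. -/
def causalEquiv {X Y : Type*} [MeasurableSpace X] [MeasurableSpace Y]
    (η : Kernel (JointPast X Y × (ℕ → X)) (ℕ → Y)) : Setoid (JointPast X Y) where
  r z z' := ∀ f : ℕ → X, η (z, f) = η (z', f)
  iseqv := ⟨fun _ _ => rfl, fun h f => (h f).symm, fun h h' f => (h f).trans (h' f)⟩

/-- Conditional mutual information `I[A ; B | C]` (in nats), as the Kullback–Leibler divergence
of the joint law of `(C, A, B)` from the law under which `(C, A)` is unchanged and `B` is drawn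
from its conditional distribution given `C` alone. Only `B` has to be standard Borel, so that
`A` may take values in an arbitrary quotient space. -/
noncomputable def condMutualInfo {Ω α β γ : Type*} [MeasurableSpace Ω] [MeasurableSpace α]
    [MeasurableSpace β] [StandardBorelSpace β] [Nonempty β] [MeasurableSpace γ]
    (P : Measure Ω) [IsFiniteMeasure P] (A : Ω → α) (B : Ω → β) (C : Ω → γ) : ℝ≥0∞ :=
  klDiv (P.map fun ω => ((C ω, A ω), B ω))
    ((P.map fun ω => (C ω, A ω)) ⊗ₘ Kernel.prodMkRight α (condDistrib B C P))

/-- The prescience `I[f(joint past) ; future output | future input]` of the random variable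
`f(joint past)`, under the law `P` of the joint input-output process. -/
noncomputable def prescience {X Y A : Type*} [MeasurableSpace X] [Countable Y] [MeasurableSpace Y]
    [DiscreteMeasurableSpace Y] [Nonempty Y] [MeasurableSpace A]
    (P : Measure ((ℤ → X) × (ℤ → Y))) [IsFiniteMeasure P] (f : JointPast X Y → A) : ℝ≥0∞ :=
  condMutualInfo P (fun ω => f (jointPast ω)) (fun ω => future ω.2) (fun ω => future ω.1)

/-- The length-`L` prescience `I[f(joint past) ; Y₀ … Y_{L-1} | X₀ … X_{L-1}]`. -/
noncomputable def finitePrescience {X Y A : Type*} [MeasurableSpace X] [Countable Y]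
    [MeasurableSpace Y] [DiscreteMeasurableSpace Y] [Nonempty Y] [MeasurableSpace A]
    (P : Measure ((ℤ → X) × (ℤ → Y))) [IsFiniteMeasure P] (L : ℕ) (f : JointPast X Y → A) :
    ℝ≥0∞ :=
  condMutualInfo P (fun ω => f (jointPast ω)) (fun ω => block 0 L ω.2) (fun ω => block 0 L ω.1)

/-- Versions of the future morphs exist for every channel. -/
theorem exists_isFutureMorph {X Y : Type*} [MeasurableSpace X] [Countable Y] [MeasurableSpace Y]
    [DiscreteMeasurableSpace Y] [Nonempty Y]
    (κ : Kernel (ℤ → X) (ℤ → Y)) [IsMarkovKernel κ] :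
    ∃ η : Kernel (JointPast X Y × (ℕ → X)) (ℕ → Y), IsMarkovKernel η ∧ IsFutureMorph κ η := by
  let glue : JointPast X Y × (ℕ → X) → ℤ → X := fun w t =>
    if 0 ≤ t then w.2 t.toNat else w.1.1 (-1 - t).toNat
  have hglue : Measurable glue := by
    refine measurable_pi_lambda _ fun t => ?_
    by_cases h : 0 ≤ t
    · simp only [glue, h, if_true]; fun_prop
    · simp only [glue, h, if_false]; fun_prop
  have hg : ∀ (x : ℤ → X) (q : ℕ → Y), glue ((past x, q), future x) = x := by
    intro x q
    ext t
    by_cases h : 0 ≤ t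
    · simp [glue, h, future]
    · simp only [glue, h, if_false, past]
      congr 1
      omega
  have hpf : Measurable fun y : ℤ → Y => (past y, future y) :=
    measurable_past.prodMk measurable_future
  let ρ : Kernel (ℤ → X) ((ℕ → Y) × (ℕ → Y)) := κ.map fun y => (past y, future y)
  have : IsMarkovKernel ρ := Kernel.IsMarkovKernel.map κ hpf
  refine ⟨ρ.condKernel.comap (fun w => (glue w, w.1.2))
    (hglue.prodMk (by fun_prop)), inferInstance, fun x => ?_⟩
  have h1 : ρ x = (ρ.fst ⊗ₖ ρ.condKernel) x := by rw [ρ.disintegrate ρ.condKernel]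
  rw [Kernel.compProd_apply_eq_compProd_sectR] at h1
  have h2 : ρ x = (κ x).map fun y => (past y, future y) := Kernel.map_apply κ hpf x
  have h3 : ρ.fst x = (κ x).map past := by
    rw [Kernel.fst_apply, h2, Measure.map_map measurable_fst hpf]
    rfl
  rw [← h2, h1, h3]
  congr 1
  ext1 q
  simp only [Kernel.sectR_apply, Kernel.comap_apply, hg]

end TransducerPrescience

/-! The inequality is data processing: a rival cell is a function of the joint past, measurable by
the choice of the quotient σ-algebra. Equality for causal states is sufficiency. If the output law
given input and joint past depends on the past only through its state, both laws compared by the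
divergence for the joint past arise from those for the state through one kernel, which resamples the
past given input and state (`compProd_comap_eq_comp`). Data processing then also runs backwards,
infinite values included.

The difficulty is measurability. `η (z, f)` is constant on causal classes, but this alone does not
make it jointly measurable in the class and `f`, which ranges over a possibly uncountable set.
Causality helps: output words of length `L` do not see inputs from time `L` on, so these may be
replaced by a constant letter. Only countably many input futures then occur
(`measurable_lift_causalEquiv`), and the probabilities of output words determine the whole
conditional law (`map_eq_compProd_condDistrib_comap`). -/

namespace TransducerPrescience

/-! ### Data processing and sufficient statistics -/

section Sufficiency

variable {Ω α α' β γ : Type*} [MeasurableSpace Ω] [MeasurableSpace α] [MeasurableSpace α']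
  [MeasurableSpace β] [MeasurableSpace γ]

/-- A joint law whose conditional kernel factors through `φ` is recovered from its image under
`φ × id` by resampling the first component from its conditional law given `φ`. -/
lemma compProd_comap_eq_comp [StandardBorelSpace α] [Nonempty α] (ν : Measure α)
    [IsFiniteMeasure ν] {φ : α → α'} (hφ : Measurable φ) (K : Kernel α' β) [IsMarkovKernel K] :
    (((condDistrib id φ ν).prodMkRight β) ×ₖ Kernel.deterministic Prod.snd measurable_snd) ∘ₘ
      (ν.map φ ⊗ₘ K) = ν ⊗ₘ K.comap φ hφ := by
  refine Measure.ext_prod fun {s t} hs ht => ?_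
  have hm : Measurable fun b => condDistrib id φ ν b s := Kernel.measurable_coe _ hs
  have hm' : Measurable fun p : α' × β => condDistrib id φ ν p.1 s * t.indicator 1 p.2 :=
    (hm.comp measurable_fst).mul ((measurable_one.indicator ht).comp measurable_snd)
  have hK : Measurable fun b => K b t := Kernel.measurable_coe _ ht
  have e : ∀ p : α' × β, (((condDistrib id φ ν).prodMkRight β) ×ₖ
      Kernel.deterministic Prod.snd measurable_snd) p (s ×ˢ t)
      = condDistrib id φ ν p.1 s * t.indicator 1 p.2 := fun p => by
    rw [Kernel.prod_apply_prod, Kernel.deterministic_apply' _ _ ht]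
    rfl
  have e' : ∀ b, ∫⁻ y, condDistrib id φ ν b s * t.indicator 1 y ∂K b
      = condDistrib id φ ν b s * K b t := fun b => by
    rw [lintegral_const_mul _ (measurable_one.indicator ht), lintegral_indicator_one ht]
  rw [Measure.bind_apply (hs.prod ht) (Kernel.aemeasurable _), lintegral_congr e,
    Measure.lintegral_compProd hm', lintegral_congr e', Measure.compProd_apply_prod hs ht]
  -- Writing the product as an integral over `a` lets `ν.map φ` and the conditional law recombine
  -- into the law of `(φ a, a)` under `ν`.
  have e2 : ∀ b, condDistrib id φ ν b s * K b t
      = ∫⁻ a, s.indicator 1 a * K b t ∂condDistrib id φ ν b := fun b => by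
    rw [lintegral_mul_const _ (measurable_one.indicator hs), lintegral_indicator_one hs]
  have hm2 : Measurable fun p : α' × α => s.indicator (1 : α → ℝ≥0∞) p.2 * K p.1 t :=
    ((measurable_one.indicator hs).comp measurable_snd).mul (hK.comp measurable_fst)
  rw [lintegral_congr e2,
    ← Measure.lintegral_compProd (f := fun p : α' × α => s.indicator 1 p.2 * K p.1 t) hm2,
    compProd_map_condDistrib (by fun_prop),
    lintegral_map hm2 (hφ.prodMk measurable_id), ← lintegral_indicator hs]
  refine lintegral_congr fun a => ?_
  by_cases ha : a ∈ s <;> simp [ha]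

/-- The divergence between two laws whose conditional kernels both factor through `φ` is not
more than the divergence between their images under `φ × id`. -/
lemma klDiv_compProd_comap_le [StandardBorelSpace α] [Nonempty α] (ν : Measure α)
    [IsFiniteMeasure ν] {φ : α → α'} (hφ : Measurable φ) (K M : Kernel α' β) [IsMarkovKernel K]
    [IsMarkovKernel M] :
    klDiv (ν ⊗ₘ K.comap φ hφ) (ν ⊗ₘ M.comap φ hφ) ≤ klDiv (ν.map φ ⊗ₘ K) (ν.map φ ⊗ₘ M) := by
  rw [← compProd_comap_eq_comp ν hφ K, ← compProd_comap_eq_comp ν hφ M]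
  exact klDiv_comp_right_le _ _ _

lemma map_compProd_comap (ν : Measure α) [IsFiniteMeasure ν] {φ : α → α'} (hφ : Measurable φ)
    (K : Kernel α' β) [IsMarkovKernel K] :
    (ν ⊗ₘ K.comap φ hφ).map (Prod.map φ id) = ν.map φ ⊗ₘ K := by
  refine Measure.ext_prod fun {s t} hs ht => ?_
  have e : Prod.map φ id ⁻¹' s ×ˢ t = (φ ⁻¹' s) ×ˢ t := rfl
  rw [Measure.map_apply (hφ.prodMap measurable_id) (hs.prod ht), e,
    Measure.compProd_apply_prod (hφ hs) ht, Measure.compProd_apply_prod hs ht,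
    setLIntegral_map hs (Kernel.measurable_coe _ ht) hφ]
  rfl

variable [StandardBorelSpace β] [Nonempty β]

/-- Data processing for the conditional mutual information. -/
theorem condMutualInfo_comp_le (P : Measure Ω) [IsFiniteMeasure P] {A : Ω → α} (hA : Measurable A)
    {B : Ω → β} (hB : Measurable B) {C : Ω → γ} (hC : Measurable C) {f : α → α'}
    (hf : Measurable f) :
    condMutualInfo P (fun ω => f (A ω)) B C ≤ condMutualInfo P A B C := by
  have hφ : Measurable (Prod.map id f : γ × α → γ × α') := measurable_id.prodMap hf
  have h1 : (P.map fun ω => ((C ω, f (A ω)), B ω))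
      = (P.map fun ω => ((C ω, A ω), B ω)).map (Prod.map (Prod.map id f) id) := by
    rw [Measure.map_map (by fun_prop) (by fun_prop)]; rfl
  have h2 : (P.map fun ω => (C ω, f (A ω))) = (P.map fun ω => (C ω, A ω)).map (Prod.map id f) := by
    rw [Measure.map_map (by fun_prop) (by fun_prop)]; rfl
  have h3 : Kernel.prodMkRight α (condDistrib B C P)
      = (Kernel.prodMkRight α' (condDistrib B C P)).comap (Prod.map id f) hφ := rfl
  unfold condMutualInfo
  rw [h1, h2, h3, ← map_compProd_comap _ hφ]
  exact klDiv_map_le _ _ (by fun_prop)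

/-- If the conditional law of `B` given `(C, A)` depends on `A` only through `f`, then `f(A)`
carries all the conditional information of `A` about `B`. -/
theorem condMutualInfo_comp_eq [StandardBorelSpace α] [Nonempty α] [StandardBorelSpace γ]
    [Nonempty γ] (P : Measure Ω) [IsFiniteMeasure P] {A : Ω → α} (hA : Measurable A)
    {B : Ω → β} (hB : Measurable B) {C : Ω → γ} (hC : Measurable C) {f : α → α'}
    (hf : Measurable f) (K : Kernel (γ × α') β) [IsMarkovKernel K]
    (hK : (P.map fun ω => ((C ω, A ω), B ω)) =
      (P.map fun ω => (C ω, A ω)) ⊗ₘ K.comap (Prod.map id f) (measurable_id.prodMap hf)) :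
    condMutualInfo P (fun ω => f (A ω)) B C = condMutualInfo P A B C := by
  refine le_antisymm (condMutualInfo_comp_le P hA hB hC hf) ?_
  have hφ : Measurable (Prod.map id f : γ × α → γ × α') := measurable_id.prodMap hf
  have h1 : (P.map fun ω => ((C ω, f (A ω)), B ω))
      = (P.map fun ω => ((C ω, A ω), B ω)).map (Prod.map (Prod.map id f) id) := by
    rw [Measure.map_map (by fun_prop) (by fun_prop)]; rfl
  have h2 : (P.map fun ω => (C ω, f (A ω))) = (P.map fun ω => (C ω, A ω)).map (Prod.map id f) := by
    rw [Measure.map_map (by fun_prop) (by fun_prop)]; rfl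
  -- The reference kernel ignores `A`, so it factors through `f` too, and one resampling kernel
  -- serves both laws.
  have h3 : Kernel.prodMkRight α (condDistrib B C P)
      = (Kernel.prodMkRight α' (condDistrib B C P)).comap (Prod.map id f) hφ := rfl
  unfold condMutualInfo
  rw [h1, h2, h3, hK, map_compProd_comap _ hφ]
  exact klDiv_compProd_comap_le _ hφ _ _

/-- If, for all `D` in a π-system generating the σ-algebra of the target of `B`, the conditional
probability of `B ∈ D` given `W` is a function of `φ(W)`, then the conditional law of `B` given
`W` is that of `B` given `φ(W)`. -/
lemma map_eq_compProd_condDistrib_comap (P : Measure Ω) [IsFiniteMeasure P] {W : Ω → α}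
    (hW : Measurable W) {B : Ω → β} (hB : Measurable B) {φ : α → α'} (hφ : Measurable φ)
    {𝒟 : Set (Set β)} (hgen : ‹MeasurableSpace β› = MeasurableSpace.generateFrom 𝒟)
    (hpi : IsPiSystem 𝒟)
    (h : ∀ D ∈ 𝒟, ∃ g : α' → ℝ≥0∞, Measurable g ∧ ∀ E, MeasurableSet E →
      P (W ⁻¹' E ∩ B ⁻¹' D) = ∫⁻ ω in W ⁻¹' E, g (φ (W ω)) ∂P) :
    (P.map fun ω => (W ω, B ω)) =
      P.map W ⊗ₘ (condDistrib B (fun ω => φ (W ω)) P).comap φ hφ := by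
  set K := condDistrib B (fun ω => φ (W ω)) P
  have hφW : Measurable fun ω => φ (W ω) := hφ.comp hW
  have hKint : ∀ s t, MeasurableSet s → MeasurableSet t →
      P ((fun ω => φ (W ω)) ⁻¹' s ∩ B ⁻¹' t) = ∫⁻ a in s, K a t ∂P.map fun ω => φ (W ω) := by
    intro s t hs ht
    rw [← Measure.compProd_apply_prod hs ht, compProd_map_condDistrib hB.aemeasurable,
      Measure.map_apply (hφW.prodMk hB) (hs.prod ht)]
    rfl
  refine Measure.ext_prod fun {s t} hs ht => ?_
  have hDmeas : ∀ D ∈ 𝒟, MeasurableSet D := fun D hD => by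
    rw [hgen]; exact MeasurableSpace.measurableSet_generateFrom hD
  -- For fixed `s`, both sides are finite measures in `t`, so they need only be compared on `𝒟` and
  -- in total mass.
  let ν₁ : Measure β := (P.restrict (W ⁻¹' s)).map B
  let ν₂ : Measure β := ((P.restrict (W ⁻¹' s)).map fun ω => φ (W ω)).bind K
  have hν₂ : ∀ t, MeasurableSet t → ν₂ t = ∫⁻ ω in W ⁻¹' s, K (φ (W ω)) t ∂P := fun t ht => by
    rw [Measure.bind_apply ht (Kernel.aemeasurable _),
      lintegral_map (Kernel.measurable_coe _ ht) hφW]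
  have hν : ν₁ = ν₂ := by
    refine ext_of_generate_finite 𝒟 hgen hpi (fun D hD => ?_) ?_
    · obtain ⟨g, hg, hgE⟩ := h D hD
      -- Testing on the sets `φ ⁻¹' s'` alone identifies `g` almost everywhere.
      have hae : g =ᵐ[P.map fun ω => φ (W ω)] fun a => K a D := by
        refine ae_eq_of_forall_setLIntegral_eq_of_sigmaFinite hg
          (Kernel.measurable_coe _ (hDmeas D hD)) fun s' hs' _ => ?_
        rw [← hKint s' D hs' (hDmeas D hD), setLIntegral_map hs' hg hφW]
        exact (hgE _ (hφ hs')).symm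
      rw [hν₂ D (hDmeas D hD), Measure.map_apply hB (hDmeas D hD),
        Measure.restrict_apply (hB (hDmeas D hD)), Set.inter_comm, hgE s hs]
      exact lintegral_congr_ae (ae_restrict_of_ae (ae_of_ae_map hφW.aemeasurable hae))
    · rw [hν₂ _ .univ, Measure.map_apply hB .univ]
      simp
  have e : (fun ω => (W ω, B ω)) ⁻¹' s ×ˢ t = B ⁻¹' t ∩ W ⁻¹' s := by
    ext; simp [and_comm]
  rw [Measure.map_apply (hW.prodMk hB) (hs.prod ht), Measure.compProd_apply_prod hs ht,
    setLIntegral_map hs (Kernel.measurable_coe _ ht) hW, e, ← Measure.restrict_apply (hB ht),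
    ← Measure.map_apply hB ht]
  exact (congrArg (fun ν => ν t) hν).trans (hν₂ t ht)

end Sufficiency

/-! ### Finite words and their constant continuations -/

section Words

variable {α : Type*}

/-- The prefix of length `L` of a one-sided sequence. -/
def wordPrefix (L : ℕ) (f : ℕ → α) : Fin L → α := fun i => f i

/-- The one-sided sequence that continues a word by a constant letter. -/
def padWord (a : α) {L : ℕ} (w : Fin L → α) : ℕ → α :=
  fun n => if h : n < L then w ⟨n, h⟩ else a

lemma wordPrefix_future (L : ℕ) (x : ℤ → α) : wordPrefix L (future x) = block 0 L x := by
  ext i; simp [wordPrefix, future, block]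

variable [MeasurableSpace α]

@[fun_prop]
lemma measurable_wordPrefix (L : ℕ) : Measurable (wordPrefix L : (ℕ → α) → _) :=
  measurable_pi_lambda _ fun _ => measurable_pi_apply _

@[fun_prop]
lemma measurable_block (t : ℤ) (L : ℕ) : Measurable (block t L : (ℤ → α) → _) :=
  measurable_pi_lambda _ fun _ => measurable_pi_apply _

@[fun_prop]
lemma measurable_padWord (a : α) (L : ℕ) : Measurable (padWord a : (Fin L → α) → _) := by
  refine measurable_pi_lambda _ fun n => ?_
  by_cases h : n < L
  · simpa [padWord, h] using measurable_pi_apply _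
  · simp [padWord, h]

@[fun_prop]
lemma measurable_jointPast {β : Type*} [MeasurableSpace β] :
    Measurable (jointPast : (ℤ → α) × (ℤ → β) → _) :=
  (measurable_past.comp measurable_fst).prodMk (measurable_past.comp measurable_snd)

end Words

/-! ### Causality and the conditional law of output words -/

section Channel

variable {X Y : Type*} [MeasurableSpace X] [MeasurableSpace Y]

/-- Under a causal channel, the law of all outputs before time `L` depends only on the inputs
before time `L`. -/
lemma IsCausalChannel.map_clamp_eq {κ : Kernel (ℤ → X) (ℤ → Y)} [IsMarkovKernel κ]
    (hκ : IsCausalChannel κ) {L : ℤ} {x x' : ℤ → X} (h : ∀ s < L, x s = x' s) :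
    (κ x).map (fun y s => y (min s (L - 1))) = (κ x').map (fun y s => y (min s (L - 1))) := by
  have hcl : Measurable fun (y : ℤ → Y) (s : ℤ) => y (min s (L - 1)) :=
    measurable_pi_lambda _ fun _ => measurable_pi_apply _
  have := Measure.isProbabilityMeasure_map (μ := κ x) hcl.aemeasurable
  have := Measure.isProbabilityMeasure_map (μ := κ x') hcl.aemeasurable
  -- Clamping the time index keeps the sequence bi-infinite, so finite-dimensional marginals
  -- determine its law; each is read off one output block.
  refine IsProjectiveLimit.unique (P := fun I => ((κ x').map
    fun y s => y (min s (L - 1))).map I.restrict) (fun I => ?_) (fun I => rfl)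
  obtain ⟨n, hnL, hn⟩ : ∃ n : ℕ, -(n : ℤ) ≤ L ∧ ∀ s ∈ I, -(n : ℤ) ≤ min s (L - 1) := by
    obtain ⟨m, hm⟩ := (I.image fun s => min s (L - 1)).bddBelow
    refine ⟨m.natAbs + L.natAbs, by omega, fun s hs => ?_⟩
    have := hm (Finset.mem_coe.2 (Finset.mem_image_of_mem (fun s => min s (L - 1)) hs))
    omega
  -- The block from `-n` of this length ends at time `L - 1`, so causality asks for agreement only
  -- before `L`.
  let N := (L + n).toNat
  have hlt : ∀ s ∈ I, (min s (L - 1) + n).toNat < N := fun s hs => by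
    have := hn s hs
    omega
  let g : (Fin N → Y) → (I → Y) := fun v s => v ⟨_, hlt s s.2⟩
  have hg : Measurable g := measurable_pi_lambda _ fun _ => measurable_pi_apply _
  have e : I.restrict ∘ (fun (y : ℤ → Y) (s : ℤ) => y (min s (L - 1))) = g ∘ block (-n) N := by
    ext y s
    simp only [Function.comp, Finset.restrict, g, block]
    congr 1
    have := hn s s.2
    omega
  beta_reduce
  rw [Measure.map_map (by fun_prop) hcl, Measure.map_map (by fun_prop) hcl, e,
    ← Measure.map_map hg (by fun_prop), ← Measure.map_map hg (by fun_prop)]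
  rw [hκ (-n) N x x' fun s hs => h s (by omega)]

lemma IsCausalChannel.map_past_block_eq {κ : Kernel (ℤ → X) (ℤ → Y)} [IsMarkovKernel κ]
    (hκ : IsCausalChannel κ) {L : ℕ} {x x' : ℤ → X} (h : ∀ s < (L : ℤ), x s = x' s) :
    (κ x).map (fun y => (past y, block 0 L y)) = (κ x').map (fun y => (past y, block 0 L y)) := by
  have e : (fun y : ℤ → Y => (past y, block 0 L y)) =
      (fun y => (past y, block 0 L y)) ∘ fun y s => y (min s ((L : ℤ) - 1)) := by
    ext y i
    · simp only [past, Function.comp]; congr 1; omega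
    · simp only [block, Function.comp]; congr 1; omega
  have hcl : Measurable fun (y : ℤ → Y) (s : ℤ) => y (min s ((L : ℤ) - 1)) :=
    measurable_pi_lambda _ fun _ => measurable_pi_apply _
  have hm : Measurable fun y : ℤ → Y => (past y, block 0 L y) :=
    measurable_past.prodMk (measurable_block 0 L)
  rw [e, ← Measure.map_map hm hcl, ← Measure.map_map hm hcl, hκ.map_clamp_eq h]

/-- Under a causal channel, the future morph evaluated at any continuation of the input word of
length `L` is a conditional law of the output word of length `L` given the output past. -/
lemma IsFutureMorph.apply_past_block {κ : Kernel (ℤ → X) (ℤ → Y)} [IsMarkovKernel κ]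
    (hκ : IsCausalChannel κ) {η : Kernel (JointPast X Y × (ℕ → X)) (ℕ → Y)} [IsMarkovKernel η]
    (hη : IsFutureMorph κ η) (a : X) (L : ℕ) (x : ℤ → X) {E : Set (ℕ → Y)} (hE : MeasurableSet E)
    {D : Set (Fin L → Y)} (hD : MeasurableSet D) :
    κ x (past ⁻¹' E ∩ block 0 L ⁻¹' D) = ∫⁻ y in past ⁻¹' E,
      η ((past x, past y), padWord a (block 0 L x)) (wordPrefix L ⁻¹' D) ∂κ x := by
  -- The morph identity holds for every input, not just almost every one, so it may be used at this
  -- modified input.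
  let x' : ℤ → X := fun s => if s < L then x s else a
  have hpast : past x' = past x := by
    ext n; simp only [past, x']; rw [if_pos (by omega)]
  have hfut : future x' = padWord a (block 0 L x) := by
    ext n; by_cases h : n < L <;> simp [future, padWord, block, x', h]
  have hxx' : ∀ s < (L : ℤ), x s = x' s := fun s hs => by simp [x', hs]
  have hmap := hκ.map_past_block_eq hxx'
  have hm : Measurable fun y : ℤ → Y => (past y, block 0 L y) :=
    measurable_past.prodMk (measurable_block 0 L)
  have hmp : (κ x).map past = (κ x').map past := by
    have := congrArg (Measure.map Prod.fst) hmap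
    rwa [Measure.map_map measurable_fst hm, Measure.map_map measurable_fst hm] at this
  have hηD : Measurable fun q : ℕ → Y =>
      η ((past x, q), padWord a (block 0 L x)) (wordPrefix L ⁻¹' D) :=
    (Kernel.measurable_coe η (measurable_wordPrefix L hD)).comp (by fun_prop)
  have h1 : κ x (past ⁻¹' E ∩ block 0 L ⁻¹' D) = κ x' (past ⁻¹' E ∩ block 0 L ⁻¹' D) := by
    have := congrArg (fun ν : Measure _ => ν (E ×ˢ D)) hmap
    rwa [Measure.map_apply hm (hE.prod hD), Measure.map_apply hm (hE.prod hD)] at this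
  have h2 := congrArg (fun ν : Measure _ => ν (E ×ˢ (wordPrefix L ⁻¹' D))) (hη x')
  rw [Measure.map_apply (measurable_past.prodMk measurable_future)
    (hE.prod (measurable_wordPrefix L hD)),
    Measure.compProd_apply_prod hE (measurable_wordPrefix L hD)] at h2
  rw [h1, ← setLIntegral_map hE hηD measurable_past, hmp]
  refine Eq.trans (congrArg _ ?_) (h2.trans ?_)
  · ext y; simp [← wordPrefix_future]
  · simp only [Kernel.comap_apply, hpast, hfut]

/-- The conditional probability of an output word given the joint past and the input future. -/
lemma IsFutureMorph.compProd_apply_block {κ : Kernel (ℤ → X) (ℤ → Y)} [IsMarkovKernel κ]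
    (hκ : IsCausalChannel κ) {η : Kernel (JointPast X Y × (ℕ → X)) (ℕ → Y)} [IsMarkovKernel η]
    (hη : IsFutureMorph κ η) (μ : Measure (ℤ → X)) [IsFiniteMeasure μ] (a : X) (L : ℕ)
    {E : Set ((ℕ → X) × JointPast X Y)} (hE : MeasurableSet E)
    {D : Set (Fin L → Y)} (hD : MeasurableSet D) :
    (μ ⊗ₘ κ) ((fun ω => (future ω.1, jointPast ω)) ⁻¹' E ∩ (fun ω => block 0 L ω.2) ⁻¹' D) =
      ∫⁻ ω in (fun ω => (future ω.1, jointPast ω)) ⁻¹' E,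
        η (jointPast ω, padWord a (block 0 L ω.1)) (wordPrefix L ⁻¹' D) ∂(μ ⊗ₘ κ) := by
  have hW : Measurable fun ω : (ℤ → X) × (ℤ → Y) => (future ω.1, jointPast ω) :=
    (measurable_future.comp measurable_fst).prodMk measurable_jointPast
  have hB : Measurable fun ω : (ℤ → X) × (ℤ → Y) => block 0 L ω.2 := by fun_prop
  have hf : Measurable fun ω : (ℤ → X) × (ℤ → Y) =>
      η (jointPast ω, padWord a (block 0 L ω.1)) (wordPrefix L ⁻¹' D) :=
    (Kernel.measurable_coe η (measurable_wordPrefix L hD)).comp (by fun_prop)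
  rw [Measure.compProd_apply ((hW hE).inter (hB hD)), ← lintegral_indicator (hW hE),
    Measure.lintegral_compProd (hf.indicator (hW hE))]
  refine lintegral_congr fun x => ?_
  have hE' : MeasurableSet {q : ℕ → Y | (future x, (past x, q)) ∈ E} :=
    (by fun_prop : Measurable fun q : ℕ → Y => (future x, (past x, q))) hE
  exact (hη.apply_past_block hκ a L x hE' hD).trans
    (lintegral_indicator (measurable_past hE') _).symm

/-- For a fixed countable supply of inputs, the morph probabilities are measurable functions of
the input and the causal state. -/
lemma measurable_lift_causalEquiv (η : Kernel (JointPast X Y × (ℕ → X)) (ℕ → Y))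
    {ι : Type*} [Countable ι] [MeasurableSpace ι] [MeasurableSingletonClass ι] (p : ι → ℕ → X)
    {D : Set (ℕ → Y)} (hD : MeasurableSet D) :
    Measurable fun q : ι × Quotient (causalEquiv η) =>
      Quotient.lift (fun z => η (z, p q.1) D) (fun z z' (h : ∀ f, η (z, f) = η (z', f)) => congrArg (fun ν : Measure _ => ν D) (h (p q.1)))
        q.2 := by
  -- Countability of `ι` reduces joint measurability to a single input, where the quotient σ-algebra
  -- gives it.
  refine measurable_from_prod_countable_right fun i => ?_
  refine measurable_from_quotient.2 ?_
  exact (Kernel.measurable_coe η hD).comp (by fun_prop : Measurable fun z => (z, p i))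

end Channel

/-! ### Prescience of rival partitions and of causal states -/

section Prescience

variable {X Y : Type*} [MeasurableSpace X]
  [Countable Y] [MeasurableSpace Y] [DiscreteMeasurableSpace Y] [Nonempty Y]

theorem prescience_le_id (P : Measure ((ℤ → X) × (ℤ → Y))) [IsFiniteMeasure P]
    {A : Type*} [MeasurableSpace A] {f : JointPast X Y → A} (hf : Measurable f) :
    prescience P f ≤ prescience P (id : JointPast X Y → JointPast X Y) :=
  condMutualInfo_comp_le P measurable_jointPast (measurable_future.comp measurable_snd)
    (measurable_future.comp measurable_fst) hf

theorem finitePrescience_le_id (P : Measure ((ℤ → X) × (ℤ → Y))) [IsFiniteMeasure P] (L : ℕ)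
    {A : Type*} [MeasurableSpace A] {f : JointPast X Y → A} (hf : Measurable f) :
    finitePrescience P L f ≤ finitePrescience P L (id : JointPast X Y → JointPast X Y) :=
  condMutualInfo_comp_le P measurable_jointPast ((measurable_block 0 L).comp measurable_snd)
    ((measurable_block 0 L).comp measurable_fst) hf

variable [Countable X] [DiscreteMeasurableSpace X]
  {κ : Kernel (ℤ → X) (ℤ → Y)} [IsMarkovKernel κ]
  {η : Kernel (JointPast X Y × (ℕ → X)) (ℕ → Y)} [IsMarkovKernel η]

theorem finitePrescience_causalEquiv (hκ : IsCausalChannel κ) (hη : IsFutureMorph κ η)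
    (μ : Measure (ℤ → X)) [IsFiniteMeasure μ] (a : X) (L : ℕ) :
    finitePrescience (μ ⊗ₘ κ) L (Quotient.mk (causalEquiv η)) =
      finitePrescience (μ ⊗ₘ κ) L (id : JointPast X Y → JointPast X Y) := by
  have : Nonempty X := ⟨a⟩
  have hB : Measurable fun ω : (ℤ → X) × (ℤ → Y) => block 0 L ω.2 := by fun_prop
  have hC : Measurable fun ω : (ℤ → X) × (ℤ → Y) => block 0 L ω.1 := by fun_prop
  refine condMutualInfo_comp_eq (μ ⊗ₘ κ) measurable_jointPast hB hC measurable_quotient_mk'' _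
    (map_eq_compProd_condDistrib_comap (μ ⊗ₘ κ) (hC.prodMk measurable_jointPast) hB _
      MeasurableSpace.generateFrom_measurableSet.symm MeasurableSpace.isPiSystem_measurableSet
      fun D hD => ⟨_, measurable_lift_causalEquiv η (padWord a : (Fin L → X) → _)
        (measurable_wordPrefix L hD), fun E hE => ?_⟩)
  have hE' : MeasurableSet (Prod.map (wordPrefix L) id ⁻¹' E : Set ((ℕ → X) × JointPast X Y)) :=
    ((measurable_wordPrefix L).prodMap measurable_id) hE
  have e : (fun ω : (ℤ → X) × (ℤ → Y) => (block 0 L ω.1, jointPast ω)) ⁻¹' E =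
      (fun ω => (future ω.1, jointPast ω)) ⁻¹' (Prod.map (wordPrefix L) id ⁻¹' E) := by
    ext ω; simp [wordPrefix_future]
  rw [e, hη.compProd_apply_block hκ μ a L hE' hD]
  rfl

/-- Cylinders suffice: each is decided by a finite output word, whose probability needs only a
finite input prefix and the causal state. -/
theorem prescience_causalEquiv (hκ : IsCausalChannel κ) (hη : IsFutureMorph κ η)
    (μ : Measure (ℤ → X)) [IsFiniteMeasure μ] (a : X) :
    prescience (μ ⊗ₘ κ) (Quotient.mk (causalEquiv η)) =
      prescience (μ ⊗ₘ κ) (id : JointPast X Y → JointPast X Y) := by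
  have : Nonempty X := ⟨a⟩
  have hB : Measurable fun ω : (ℤ → X) × (ℤ → Y) => future ω.2 :=
    measurable_future.comp measurable_snd
  have hC : Measurable fun ω : (ℤ → X) × (ℤ → Y) => future ω.1 :=
    measurable_future.comp measurable_fst
  refine condMutualInfo_comp_eq (μ ⊗ₘ κ) measurable_jointPast hB hC measurable_quotient_mk'' _
    (map_eq_compProd_condDistrib_comap (μ ⊗ₘ κ) (hC.prodMk measurable_jointPast) hB _
      generateFrom_measurableCylinders.symm isPiSystem_measurableCylinders
      fun D hD => ?_)
  obtain ⟨I, S, hS, rfl⟩ := (mem_measurableCylinders D).1 hD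
  obtain ⟨L, hL⟩ : ∃ L : ℕ, ∀ i ∈ I, i < L :=
    ⟨I.sup id + 1, fun i hi => Nat.lt_succ_of_le (Finset.le_sup (f := id) hi)⟩
  let g : (Fin L → Y) → (I → Y) := fun v i => v ⟨i, hL i i.2⟩
  have hD' : MeasurableSet (g ⁻¹' S) :=
    (measurable_pi_lambda g fun _ => measurable_pi_apply _) hS
  refine ⟨fun q => _, (measurable_lift_causalEquiv η (padWord a : (Fin L → X) → _)
    (measurable_wordPrefix L hD')).comp ((measurable_wordPrefix L).prodMap measurable_id),
    fun E hE => ?_⟩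
  have e : (fun ω : (ℤ → X) × (ℤ → Y) => future ω.2) ⁻¹' cylinder I S =
      (fun ω => block 0 L ω.2) ⁻¹' (g ⁻¹' S) := by
    ext ω; simp only [← wordPrefix_future]; rfl
  rw [e, hη.compProd_apply_block hκ μ a L hE hD']
  simp only [← wordPrefix_future]
  rfl

end Prescience

end TransducerPrescience

theorem mainTheorem1 {X Y : Type*}
    [Countable X] [MeasurableSpace X] [DiscreteMeasurableSpace X]
    [Countable Y] [MeasurableSpace Y] [DiscreteMeasurableSpace Y] [Nonempty Y]
    (κ : Kernel (ℤ → X) (ℤ → Y)) [IsMarkovKernel κ]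
    (hstat : TransducerPrescience.IsStationaryChannel κ)
    (hcausal : TransducerPrescience.IsCausalChannel κ)
    (μ : Measure (ℤ → X)) [IsProbabilityMeasure μ]
    (hμ : TransducerPrescience.IsStationaryProcess μ)
    (η : Kernel (TransducerPrescience.JointPast X Y × (ℕ → X)) (ℕ → Y)) [IsMarkovKernel η]
    (hη : TransducerPrescience.IsFutureMorph κ η) :
    (TransducerPrescience.prescience (μ ⊗ₘ κ)
          (Quotient.mk (TransducerPrescience.causalEquiv η)) =
        TransducerPrescience.prescience (μ ⊗ₘ κ)
          (id : TransducerPrescience.JointPast X Y → TransducerPrescience.JointPast X Y) ∧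
      ∀ r : Setoid (TransducerPrescience.JointPast X Y),
        TransducerPrescience.prescience (μ ⊗ₘ κ) (Quotient.mk r) ≤
          TransducerPrescience.prescience (μ ⊗ₘ κ)
            (Quotient.mk (TransducerPrescience.causalEquiv η))) ∧
    ∀ L : ℕ,
      TransducerPrescience.finitePrescience (μ ⊗ₘ κ) L
          (Quotient.mk (TransducerPrescience.causalEquiv η)) =
        TransducerPrescience.finitePrescience (μ ⊗ₘ κ) L
          (id : TransducerPrescience.JointPast X Y → TransducerPrescience.JointPast X Y) ∧
      ∀ r : Setoid (TransducerPrescience.JointPast X Y),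
        TransducerPrescience.finitePrescience (μ ⊗ₘ κ) L (Quotient.mk r) ≤
          TransducerPrescience.finitePrescience (μ ⊗ₘ κ) L
            (Quotient.mk (TransducerPrescience.causalEquiv η)) := by

  -- Some input sequence exists, and any of its letters serves as padding.
  obtain ⟨x⟩ := nonempty_of_isProbabilityMeasure μ
  have h := TransducerPrescience.prescience_causalEquiv hcausal hη μ (x 0)
  have h' := TransducerPrescience.finitePrescience_causalEquiv hcausal hη μ (x 0)
  exact ⟨⟨h, fun r => h ▸ TransducerPrescience.prescience_le_id _ measurable_quotient_mk''⟩,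
    fun L => ⟨h' L, fun r =>
      h' L ▸ TransducerPrescience.finitePrescience_le_id _ L measurable_quotient_mk''⟩⟩
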